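/- Work with two qubits, i.e. on $\mathbb{C}^2\otimes\mathbb{C}^2$, and with transpositions taken in the computational (that is, $\sigma_z$-eigenvector) basis. A state is a density matrix; it is separable if it is a convex combination of pure product states $|a\rangle\langle a|\otimes|b\rangle\langle b|$, and entangled otherwise. A Hermitian operator $W$ is an entanglement witness if $\mathrm{Tr}(W\sigma)\ge 0$ for every separable state $\sigma$ and $\mathrm{Tr}(W\rho)<0$ for some entangled state $\rho$; in the latter case $W$ is said to detect $\rho$. Let $EW_4$ be the set of entanglement witnesses of the form $W=\sum_{i,j\in\{0,x,z\}}c_{ij}\,\sigma_i\otimes\sigma_j$ with real $c_{ij}$, where $\sigma_0=\mathbb{1}$ and $\sigma_x,\sigma_z$ are Pauli matrices. A witness $W\in EW_4$ is called optimal in $EW_4$ if no other element of $EW_4$ detects all entangled states detected by $W$, where positive multiples of a witness are identified: every $W'\in EW_4$ that detects all entangled states detected by $W$ equals $rW$ for some real $r>0$. Theorem. Consider the family of operators $W=\tfrac12\left(Q+Q^{T_P}\right)$, where $Q=|\phi_e\rangle\langle\phi_e|$, the normalized vector $|\phi_e\rangle$ ranges over the entangled pure two-qubit states with real coefficients in the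 computational basis, and $T_P$ is the transposition with respect to one (either one) of the two subsystems. Then every element of this family is an entanglement witness, belongs to $EW_4$ and is optimal in $EW_4$. Moreover, every entangled state that is detected by some element of $EW_4$ is detected by some element of this family. -/

import Mathlib

open scoped Kronecker ComplexOrder

namespace TwoQubit

/-- Operators on `ℂ² ⊗ ℂ²`, as matrices in the computational (`σ_z`) product basis. -/
abbrev Op : Type := Matrix (Fin 2 × Fin 2) (Fin 2 × Fin 2) ℂ

/-- The (unnormalized) projector `|v⟩⟨v|`. -/
def ketBra {n : Type*} (v : n → ℂ) : Matrix n n ℂ :=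
  Matrix.vecMulVec v (star v)

/-- A unit vector of `ℂⁿ` for the Euclidean norm. -/
def IsUnitVec {n : Type*} [Fintype n] (v : n → ℂ) : Prop :=
  ∑ i, ‖v i‖ ^ 2 = 1

/-- A density matrix on two qubits. -/
def IsState (ρ : Op) : Prop :=
  ρ.PosSemidef ∧ ρ.trace = 1

/-- The pure product states `|a⟩⟨a| ⊗ |b⟩⟨b|`. -/
def productStates : Set Op :=
  {σ | ∃ a b : Fin 2 → ℂ, IsUnitVec a ∧ IsUnitVec b ∧ σ = ketBra a ⊗ₖ ketBra b}

/-- Separable states are the (finite) convex combinations of pure product states. -/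
def IsSeparable (σ : Op) : Prop :=
  σ ∈ convexHull ℝ productStates

/-- A state is entangled if it is not separable. -/
def IsEntangled (ρ : Op) : Prop :=
  IsState ρ ∧ ¬ IsSeparable ρ

/-- The expectation value `Tr (W ρ)`, a real number when `W` and `ρ` are Hermitian. -/
noncomputable def expect (W ρ : Op) : ℝ :=
  (W * ρ).trace.re

/-- The operator `W` detects the entangled state `ρ`. -/
def Detects (W ρ : Op) : Prop :=
  IsEntangled ρ ∧ expect W ρ < 0

/-- Entanglement witnesses: Hermitian operators whose expectation value is nonnegative on all
separable states and which detect some entangled state. -/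
def IsWitness (W : Op) : Prop :=
  W.IsHermitian ∧ (∀ σ, IsSeparable σ → 0 ≤ expect W σ) ∧ ∃ ρ, Detects W ρ

/-- The matrices `σ_0 = 1`, `σ_x`, `σ_z`. -/
def sigma0xz : Fin 3 → Matrix (Fin 2) (Fin 2) ℂ :=
  ![1, !![0, 1; 1, 0], !![1, 0; 0, -1]]

/-- The witnesses that are real linear combinations of `σ_i ⊗ σ_j` with `i, j ∈ {0, x, z}`. -/
def EW4 : Set Op :=
  {W | IsWitness W ∧
    ∃ c : Fin 3 → Fin 3 → ℝ, W = ∑ i, ∑ j, (c i j : ℂ) • (sigma0xz i ⊗ₖ sigma0xz j)}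

/-- Transposition with respect to the first subsystem. -/
def partialTransposeA (M : Op) : Op :=
  Matrix.of fun p q => M (q.1, p.2) (p.1, q.2)

/-- Transposition with respect to the second subsystem. -/
def partialTransposeB (M : Op) : Op :=
  Matrix.of fun p q => M (p.1, q.2) (q.1, p.2)

/-- `W` is optimal in the class `C`: no other element of `C` detects all the entangled states
detected by `W`. A positive multiple of a witness is the same witness up to normalization, so
"other" means: not a positive multiple of `W`. -/
def IsOptimalIn (C : Set Op) (W : Op) : Prop :=
  W ∈ C ∧ ∀ W' ∈ C, (∀ ρ, Detects W ρ → Detects W' ρ) → ∃ r : ℝ, 0 < r ∧ W' = (r : ℂ) • W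

/-- The projector `|φ⟩⟨φ|` of a vector with real coefficients in the computational basis. -/
def realProj (φ : Fin 2 × Fin 2 → ℝ) : Op :=
  ketBra fun p => (φ p : ℂ)

/-- The operators `(Q + Q^T) / 2`, where `Q` is the projector of a real entangled pure state and
`T` is a given operation (one of the two partial transpositions). Normalization of the vector
is part of `IsEntangled`. -/
def realFamily (T : Op → Op) : Set Op :=
  {W | ∃ φ : Fin 2 × Fin 2 → ℝ, IsEntangled (realProj φ) ∧
    W = (1 / 2 : ℂ) • (realProj φ + T (realProj φ))}

end TwoQubit

/-! A member of `EW4` is a real symmetric matrix invariant under partial transposition, and its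
quadratic form is nonnegative on real product vectors, the zeros of the indefinite form `coeffDet`.
Finsler's lemma makes it positive semidefinite after adding a multiple of `detMatrix`, hence a sum
of rank-one matrices. Averaging with the partial transpose removes `detMatrix`, so the witness is a
sum of operators `symProj ψ` (`exists_eq_sum_symProj`).

If the sum is negative on a state, so is some term. Its vector is not a product, and normalizing it
gives a detecting family member.

For optimality, let `W'` detect all that `symProj φ` detects. Mixing with a detected state shows
that `W'` is nonpositive on real product vectors orthogonal to `φ` (`expect_nonpos_of_finer`). There
`W'` is a sum of squares of overlaps, so each `ψ k` is orthogonal to them and hence a multiple of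
`φ`. -/

/-! ### Finsler's lemma -/

/-- If a quadratic form `q` is nonnegative on the isotropic vectors of an indefinite quadratic form
`e`, then some `q + t • e` is nonnegative everywhere (Finsler's lemma). -/
theorem QuadraticForm.exists_nonneg_add_smul {V : Type*} [AddCommGroup V] [Module ℝ V]
    (q e : QuadraticForm ℝ V) {u v : V} (hu : 0 < e u) (hv : e v < 0)
    (h : ∀ z, e z = 0 → 0 ≤ q z) : ∃ t : ℝ, ∀ z, 0 ≤ q z + t * e z := by
  have key : ∀ z w, 0 < e z → e w < 0 → 0 ≤ (-e w) * q z + e z * q w := by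
    intro z w hz hw
    have expand : ∀ (f : QuadraticForm ℝ V) (s : ℝ),
        f (z + s • w) = f z + s * QuadraticMap.polar f z w + s * s * f w := by
      intro f s
      rw [QuadraticMap.map_add f, QuadraticMap.map_smul, QuadraticMap.polar_smul_right,
        smul_eq_mul, smul_eq_mul]
      ring
    set p := QuadraticMap.polar e z w
    set D := Real.sqrt (p ^ 2 - 4 * e z * e w)
    have hpos : 0 < p ^ 2 - 4 * e z * e w := by nlinarith [sq_nonneg p, mul_pos hz (neg_pos.2 hw)]
    have hD : D ^ 2 = p ^ 2 - 4 * e z * e w := Real.sq_sqrt hpos.le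
    have hD0 : 0 < D := Real.sqrt_pos.2 hpos
    have hw' : e w ≠ 0 := hw.ne
    have hDp : |p| < D := by
      apply abs_lt_of_sq_lt_sq _ hD0.le
      rw [hD]; nlinarith [mul_pos hz (neg_pos.2 hw)]
    obtain ⟨hp1, hp2⟩ := abs_lt.1 hDp
    -- The line through `z` in direction `w` meets the cone `e = 0` at two parameters of opposite
    -- sign, given by `d = D` and `d = -D`.
    have root : ∀ d : ℝ, d ^ 2 = p ^ 2 - 4 * e z * e w →
        0 ≤ (2 * -e w) ^ 2 * q z + (p + d) * (2 * -e w) * QuadraticMap.polar q z w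
          + (p + d) ^ 2 * q w := by
      intro d hd
      have h0 : e (z + ((p + d) / (2 * -e w)) • w) = 0 := by
        rw [expand]
        change e z + _ * p + _ = 0
        field_simp
        linear_combination hd
      have h1 := h _ h0
      rw [expand] at h1
      have h2 := mul_nonneg h1 (sq_nonneg (2 * -e w))
      refine h2.trans_eq ?_
      have hw2 : -e w ≠ 0 := neg_ne_zero.2 hw'
      field_simp
    -- The weights `D - p` and `p + D` cancel the polar term of `q`.
    have r1 := mul_nonneg (sub_pos.2 hp2).le (root D hD)
    have r2 := mul_nonneg (by linarith : 0 ≤ p + D) (root (-D) (by rw [neg_sq, hD]))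
    have h3 : 0 ≤ (8 * D * (-e w)) * ((-e w) * q z + e z * q w) := by
      refine (add_nonneg r1 r2).trans_eq ?_
      linear_combination (2 * D * q w) * hD
    exact nonneg_of_mul_nonneg_right h3 (by nlinarith [mul_pos hD0 (neg_pos.2 hw)])
  -- Points with `e > 0` bound `t` below, those with `e < 0` bound it above; `key` makes the bounds
  -- compatible.
  let S : Set ℝ := {t | ∃ z, 0 < e z ∧ t = -q z / e z}
  have hle : ∀ w, e w < 0 → ∀ t ∈ S, t ≤ q w / (-e w) := by
    rintro w hw t ⟨z, hz, rfl⟩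
    rw [div_le_div_iff₀ hz (neg_pos.2 hw)]
    linarith [key z w hz hw]
  have hbdd : BddAbove S := ⟨_, hle v hv⟩
  refine ⟨sSup S, fun z => ?_⟩
  rcases lt_trichotomy (e z) 0 with hz | hz | hz
  · have h1 : sSup S ≤ q z / (-e z) := csSup_le ⟨_, u, hu, rfl⟩ (hle z hz)
    rw [le_div_iff₀ (neg_pos.2 hz)] at h1
    linarith
  · rw [hz, mul_zero, add_zero]
    exact h z hz
  · have h1 : -q z / e z ≤ sSup S := le_csSup hbdd ⟨z, hz, rfl⟩
    rw [div_le_iff₀ hz] at h1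
    linarith

namespace TwoQubit

/-! ### Symmetrized projectors and real entangled vectors -/

/-- The determinant of the coefficient matrix of a real two-qubit vector. -/
def coeffDet (φ : Fin 2 × Fin 2 → ℝ) : ℝ :=
  φ (0, 0) * φ (1, 1) - φ (0, 1) * φ (1, 0)

/-- The average of `|φ⟩⟨φ|` and its partial transpose, written entrywise. -/
noncomputable def symProj (φ : Fin 2 × Fin 2 → ℝ) : Op :=
  Matrix.of fun p q => (((φ p * φ q + φ (p.1, q.2) * φ (q.1, p.2)) / 2 : ℝ) : ℂ)

/-- A vector orthogonal to `φ` whose projector has a negative expectation value in `symProj φ` as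
soon as `φ` is entangled. -/
def twist (φ : Fin 2 × Fin 2 → ℝ) : Fin 2 × Fin 2 → ℝ :=
  fun p => if p.2 = 0 then -φ (p.1, 1) else φ (p.1, 0)

theorem half_smul_realProj_add {T : Op → Op} (hT : T = partialTransposeA ∨ T = partialTransposeB)
    (φ : Fin 2 × Fin 2 → ℝ) :
    (1 / 2 : ℂ) • (realProj φ + T (realProj φ)) = symProj φ := by
  rcases hT with rfl | rfl <;> ext p q <;>
    simp [symProj, realProj, ketBra, partialTransposeA, partialTransposeB, Matrix.vecMulVec] <;> ring

theorem expect_add_right (W ρ σ : Op) : expect W (ρ + σ) = expect W ρ + expect W σ := by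
  simp [expect, Matrix.mul_add]

theorem expect_smul_right (W ρ : Op) (r : ℝ) : expect W (r • ρ) = r * expect W ρ := by
  simp [expect, Matrix.trace_smul]

theorem expect_sum_left {ι : Type*} (s : Finset ι) (W : ι → Op) (ρ : Op) :
    expect (∑ k ∈ s, W k) ρ = ∑ k ∈ s, expect (W k) ρ := by
  simp [expect, Finset.sum_mul, Matrix.trace_sum]

theorem expect_nonneg_of_isSeparable {W σ : Op} (h : ∀ τ ∈ productStates, 0 ≤ expect W τ)
    (hσ : IsSeparable σ) : 0 ≤ expect W σ := by
  have hconv : Convex ℝ {τ : Op | 0 ≤ expect W τ} := by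
    intro x hx y hy a b ha hb _
    simp only [Set.mem_ofPred_eq] at *
    rw [expect_add_right, expect_smul_right, expect_smul_right]
    positivity
  exact convexHull_min h hconv hσ

/-- Moving the partial transposition onto a product state conjugates one factor, so both halves are
squared overlaps. -/
theorem expect_symProj_kronecker (φ : Fin 2 × Fin 2 → ℝ) (a b : Fin 2 → ℂ) :
    expect (symProj φ) (ketBra a ⊗ₖ ketBra b) =
      (Complex.normSq (∑ p, φ p * (a p.1 * b p.2))
        + Complex.normSq (∑ p, φ p * (a p.1 * star (b p.2)))) / 2 := by
  simp [expect, symProj, ketBra, Matrix.trace, Matrix.mul_apply, Fintype.sum_prod_type,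
    Matrix.vecMulVec, Complex.normSq_apply]
  ring

theorem expect_symProj_nonneg (φ : Fin 2 × Fin 2 → ℝ) {σ : Op} (hσ : IsSeparable σ) :
    0 ≤ expect (symProj φ) σ := by
  refine expect_nonneg_of_isSeparable ?_ hσ
  rintro _ ⟨a, b, -, -, rfl⟩
  rw [expect_symProj_kronecker]
  have := Complex.normSq_nonneg (∑ p, φ p * (a p.1 * b p.2))
  have := Complex.normSq_nonneg (∑ p, φ p * (a p.1 * star (b p.2)))
  positivity

theorem expect_map_realProj (w : Matrix (Fin 2 × Fin 2) (Fin 2 × Fin 2) ℝ)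
    (z : Fin 2 × Fin 2 → ℝ) :
    expect (w.map (fun r : ℝ => (r : ℂ))) (realProj z) = z ⬝ᵥ w.mulVec z := by
  simp [expect, realProj, ketBra, Matrix.trace, Matrix.mul_apply,
    Matrix.vecMulVec, dotProduct, Matrix.mulVec, Finset.mul_sum]
  refine Finset.sum_congr rfl fun p _ => Finset.sum_congr rfl fun q _ => ?_
  ring

/-- The entries of the averaged operator differ from those of the projector by 2×2 minors of `φ`,
that is, by `-coeffDet φ` times the matrix of the form `coeffDet`. -/
theorem expect_symProj_realProj (φ z : Fin 2 × Fin 2 → ℝ) :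
    expect (symProj φ) (realProj z) = (φ ⬝ᵥ z) ^ 2 - coeffDet φ * coeffDet z := by
  simp [expect, symProj, realProj, ketBra, Matrix.trace, Matrix.mul_apply, Fintype.sum_prod_type,
    Matrix.vecMulVec, dotProduct, coeffDet]
  ring

/-- `twist` multiplies the coefficient matrix by a quarter-turn rotation. -/
theorem coeffDet_twist (φ : Fin 2 × Fin 2 → ℝ) : coeffDet (twist φ) = coeffDet φ := by
  simp [coeffDet, twist]; ring

theorem dotProduct_twist (φ : Fin 2 × Fin 2 → ℝ) : φ ⬝ᵥ twist φ = 0 := by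
  simp [twist, dotProduct, Fintype.sum_prod_type]; ring

theorem twist_dotProduct_self (φ : Fin 2 × Fin 2 → ℝ) : twist φ ⬝ᵥ twist φ = φ ⬝ᵥ φ := by
  simp [twist, dotProduct, Fintype.sum_prod_type]; ring

theorem isState_realProj_iff (φ : Fin 2 × Fin 2 → ℝ) : IsState (realProj φ) ↔ φ ⬝ᵥ φ = 1 := by
  have h : (realProj φ).trace = ((φ ⬝ᵥ φ : ℝ) : ℂ) := by
    simp [realProj, ketBra, Matrix.trace, Matrix.vecMulVec, dotProduct]
  have h2 : (realProj φ).PosSemidef := Matrix.posSemidef_vecMulVec_self_star _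
  rw [IsState, h]
  exact ⟨fun h => by exact_mod_cast h.2, fun h => ⟨h2, by exact_mod_cast h⟩⟩

theorem exists_eq_mul_of_coeffDet_eq_zero {z : Fin 2 × Fin 2 → ℝ} (h : coeffDet z = 0) :
    ∃ x y : Fin 2 → ℝ, ∀ p, z p = x p.1 * y p.2 := by
  unfold coeffDet at h
  by_cases h0 : z (0, 0) = 0
  · by_cases h1 : z (0, 1) = 0
    · refine ⟨![0, 1], ![z (1, 0), z (1, 1)], ?_⟩
      rintro ⟨i, j⟩; fin_cases i <;> fin_cases j <;> simp [h0, h1]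
    · refine ⟨![1, z (1, 1) / z (0, 1)], ![z (0, 0), z (0, 1)], ?_⟩
      rintro ⟨i, j⟩; fin_cases i <;> fin_cases j <;> simp <;> field_simp
      linarith
  · refine ⟨![1, z (1, 0) / z (0, 0)], ![z (0, 0), z (0, 1)], ?_⟩
    rintro ⟨i, j⟩; fin_cases i <;> fin_cases j <;> simp <;> field_simp
    linarith

theorem realProj_mem_productStates {z : Fin 2 × Fin 2 → ℝ} (hz : z ⬝ᵥ z = 1)
    (h : coeffDet z = 0) : realProj z ∈ productStates := by
  obtain ⟨x, y, hxy⟩ := exists_eq_mul_of_coeffDet_eq_zero h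
  set r := Real.sqrt (∑ i, x i ^ 2)
  have hr : r ^ 2 = ∑ i, x i ^ 2 := Real.sq_sqrt (by positivity)
  have h1 : r ^ 2 * ∑ j, y j ^ 2 = 1 := by
    rw [hr, ← hz]
    simp [dotProduct, Fintype.sum_prod_type, hxy]; ring
  have hr0 : r ≠ 0 := by rintro h; simp [h] at h1
  refine ⟨fun i => ((x i / r : ℝ) : ℂ), fun j => ((r * y j : ℝ) : ℂ), ?_, ?_, ?_⟩
  · simp only [IsUnitVec, Complex.norm_real, Real.norm_eq_abs, sq_abs, div_pow]
    rw [← Finset.sum_div, ← hr]; field_simp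
  · simp only [IsUnitVec, Complex.norm_real, Real.norm_eq_abs, sq_abs, mul_pow]
    rw [← Finset.mul_sum, h1]
  · ext p q
    have hr0' : (r : ℂ) ≠ 0 := by exact_mod_cast hr0
    simp [realProj, ketBra, Matrix.vecMulVec, hxy]
    field_simp

theorem isEntangled_of_expect_neg {φ : Fin 2 × Fin 2 → ℝ} {ρ : Op} (hρ : IsState ρ)
    (h : expect (symProj φ) ρ < 0) : IsEntangled ρ :=
  ⟨hρ, fun hs => absurd (expect_symProj_nonneg φ hs) h.not_ge⟩

theorem isEntangled_realProj_iff (φ : Fin 2 × Fin 2 → ℝ) :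
    IsEntangled (realProj φ) ↔ φ ⬝ᵥ φ = 1 ∧ coeffDet φ ≠ 0 := by
  constructor
  · rintro ⟨h1, h2⟩
    rw [isState_realProj_iff] at h1
    exact ⟨h1, fun h => h2 (subset_convexHull ℝ _ (realProj_mem_productStates h1 h))⟩
  · rintro ⟨h1, h2⟩
    refine isEntangled_of_expect_neg (φ := twist φ) ((isState_realProj_iff φ).2 h1) ?_
    rw [expect_symProj_realProj, dotProduct_comm, dotProduct_twist, coeffDet_twist]
    nlinarith [mul_self_pos.2 h2]

theorem expect_symProj_twist (φ : Fin 2 × Fin 2 → ℝ) :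
    expect (symProj φ) (realProj (twist φ)) = -coeffDet φ ^ 2 := by
  rw [expect_symProj_realProj, dotProduct_twist, coeffDet_twist]; ring

theorem detects_twist {φ : Fin 2 × Fin 2 → ℝ} (h : IsEntangled (realProj φ)) :
    Detects (symProj φ) (realProj (twist φ)) := by
  rw [isEntangled_realProj_iff] at h
  refine ⟨?_, ?_⟩
  · rw [isEntangled_realProj_iff, twist_dotProduct_self, coeffDet_twist]
    exact h
  · rw [expect_symProj_twist]
    have := h.2
    have : 0 < coeffDet φ ^ 2 := by positivity
    linarith

theorem isWitness_symProj {φ : Fin 2 × Fin 2 → ℝ} (h : IsEntangled (realProj φ)) :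
    IsWitness (symProj φ) := by
  refine ⟨?_, fun σ hσ => expect_symProj_nonneg φ hσ, _, detects_twist h⟩
  ext p q
  simp [symProj]
  ring

theorem symProj_mem_EW4 {φ : Fin 2 × Fin 2 → ℝ} (h : IsEntangled (realProj φ)) :
    symProj φ ∈ EW4 := by
  -- Hilbert–Schmidt coefficients of the projector; products of Paulis have squared norm 4, and
  -- averaging removes the remaining `σ_y ⊗ σ_y` term.
  refine ⟨isWitness_symProj h, fun i j => (∑ p, ∑ q, φ p * φ q *
    ((sigma0xz i ⊗ₖ sigma0xz j) p q).re) / 4, ?_⟩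
  ext ⟨i, j⟩ ⟨k, l⟩
  fin_cases i <;> fin_cases j <;> fin_cases k <;> fin_cases l <;>
    simp [symProj, sigma0xz, Fin.sum_univ_three, Fintype.sum_prod_type, Matrix.add_apply] <;> ring

/-! ### Decomposition of witnesses -/

/-- The symmetric matrix of the quadratic form `coeffDet`. -/
noncomputable def detMatrix : Matrix (Fin 2 × Fin 2) (Fin 2 × Fin 2) ℝ :=
  Matrix.of fun p q =>
    if p.1 ≠ q.1 ∧ p.2 ≠ q.2 then (if p.1 = p.2 then 1 / 2 else -1 / 2) else 0

theorem dotProduct_detMatrix_mulVec (z : Fin 2 × Fin 2 → ℝ) :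
    z ⬝ᵥ detMatrix.mulVec z = coeffDet z := by
  simp [detMatrix, coeffDet, dotProduct, Matrix.mulVec, Fintype.sum_prod_type]
  ring

theorem exists_real_of_pauli_expansion {W : Op} {c : Fin 3 → Fin 3 → ℝ}
    (h : W = ∑ i, ∑ j, (c i j : ℂ) • (sigma0xz i ⊗ₖ sigma0xz j)) :
    ∃ w : Matrix (Fin 2 × Fin 2) (Fin 2 × Fin 2) ℝ, W = w.map (fun r : ℝ => (r : ℂ)) ∧
      w.transpose = w ∧ ∀ i j k l, w (i, j) (k, l) = w (k, j) (i, l) := by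
  let τ : Fin 3 → Matrix (Fin 2) (Fin 2) ℝ := ![1, !![0, 1; 1, 0], !![1, 0; 0, -1]]
  have hτ : ∀ i a b, sigma0xz i a b = (τ i a b : ℂ) := by
    intro i a b
    fin_cases i <;> fin_cases a <;> fin_cases b <;> simp [sigma0xz, τ]
  have hs : ∀ i a b, τ i a b = τ i b a := by
    intro i a b
    fin_cases i <;> fin_cases a <;> fin_cases b <;> simp [τ]
  refine ⟨Matrix.of fun p q => ∑ i, ∑ j, c i j * (τ i p.1 q.1 * τ j p.2 q.2), ?_, ?_, ?_⟩
  · ext p q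
    simp [h, Matrix.sum_apply, hτ]
  · ext p q
    simp only [Matrix.transpose_apply, Matrix.of_apply]
    exact Finset.sum_congr rfl fun i _ => Finset.sum_congr rfl fun j _ => by
      rw [hs i q.1, hs j q.2]
  · intro i j k l
    simp only [Matrix.of_apply]
    exact Finset.sum_congr rfl fun a _ => Finset.sum_congr rfl fun b _ => by
      rw [hs a i]

theorem exists_pos_smul_normalized {z : Fin 2 × Fin 2 → ℝ} (h : z ≠ 0) :
    ∃ r : ℝ, 0 < r ∧ (r • z) ⬝ᵥ (r • z) = 1 := by
  have h0 : 0 ≤ z ⬝ᵥ z := Finset.sum_nonneg fun p _ => mul_self_nonneg (z p)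
  have hpos : 0 < z ⬝ᵥ z := lt_of_le_of_ne h0 fun h' => h (dotProduct_self_eq_zero.1 h'.symm)
  refine ⟨(Real.sqrt (z ⬝ᵥ z))⁻¹, inv_pos.2 (Real.sqrt_pos.2 hpos), ?_⟩
  rw [smul_dotProduct, dotProduct_smul, smul_eq_mul, smul_eq_mul, ← mul_assoc, ← mul_inv,
    Real.mul_self_sqrt h0, inv_mul_cancel₀ hpos.ne']

theorem coeffDet_smul (r : ℝ) (z : Fin 2 × Fin 2 → ℝ) : coeffDet (r • z) = r ^ 2 * coeffDet z := by
  simp [coeffDet]; ring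

/-- Every witness in `EW4` is a sum of operators `symProj ψ`: a nonnegative biquadratic form on
`ℝ² × ℝ²` is a sum of squares of bilinear forms. -/
theorem exists_eq_sum_symProj {W : Op} (hW : W ∈ EW4) :
    ∃ (m : ℕ) (ψ : Fin m → Fin 2 × Fin 2 → ℝ), W = ∑ k, symProj (ψ k) := by
  obtain ⟨⟨-, hsep, -⟩, c, hc⟩ := hW
  obtain ⟨w, rfl, hsymm, hpt⟩ := exists_real_of_pauli_expansion hc
  have apply_eq : ∀ (M : Matrix (Fin 2 × Fin 2) (Fin 2 × Fin 2) ℝ) z,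
      M.toQuadraticForm' z = z ⬝ᵥ M.mulVec z := fun M z =>
    Matrix.toLinearMap₂'_apply' M z z
  obtain ⟨t, ht⟩ := QuadraticForm.exists_nonneg_add_smul w.toQuadraticForm'
    detMatrix.toQuadraticForm' (u := fun p => if p.1 = p.2 then 1 else 0)
    (v := fun p => if p.1 = p.2 then 0 else 1)
    (by rw [apply_eq, dotProduct_detMatrix_mulVec]; simp [coeffDet])
    (by rw [apply_eq, dotProduct_detMatrix_mulVec]; simp [coeffDet])
    (by
      intro z hz
      rw [apply_eq, dotProduct_detMatrix_mulVec] at hz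
      rw [apply_eq]
      by_cases h0 : z = 0
      · simp [h0]
      obtain ⟨r, hr, hr1⟩ := exists_pos_smul_normalized h0
      have hprod := realProj_mem_productStates hr1 (by rw [coeffDet_smul, hz, mul_zero])
      have h1 := hsep _ (subset_convexHull ℝ _ hprod)
      rw [expect_map_realProj, Matrix.mulVec_smul, smul_dotProduct, dotProduct_smul,
        smul_eq_mul, smul_eq_mul] at h1
      exact nonneg_of_mul_nonneg_right (nonneg_of_mul_nonneg_right h1 hr) hr)
  have hpsd : (w + t • detMatrix).PosSemidef := by
    refine Matrix.PosSemidef.of_dotProduct_mulVec_nonneg ?_ fun z => ?_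
    · rw [Matrix.IsHermitian, Matrix.conjTranspose_eq_transpose_of_trivial,
        Matrix.transpose_add, hsymm, Matrix.transpose_smul]
      congr 2
      ext ⟨i, j⟩ ⟨k, l⟩
      fin_cases i <;> fin_cases j <;> fin_cases k <;> fin_cases l <;> simp [detMatrix]
    · have := ht z
      rw [apply_eq, apply_eq] at this
      rwa [star_trivial, Matrix.add_mulVec, Matrix.smul_mulVec, dotProduct_add, dotProduct_smul,
        smul_eq_mul]
  obtain ⟨m, ψ, hψ⟩ := Matrix.posSemidef_iff_eq_sum_vecMulVec.1 hpsd
  refine ⟨m, ψ, ?_⟩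
  have hentry : ∀ p q, ∑ k, ψ k p * ψ k q = w p q + t * detMatrix p q := by
    intro p q
    have := congrFun (congrFun hψ p) q
    simpa [Matrix.sum_apply, Matrix.vecMulVec_apply] using this.symm
  -- Partial transposition fixes `w` and negates `detMatrix`, so averaging leaves only `w`.
  have hanti : ∀ i j k l, detMatrix (i, l) (k, j) = -detMatrix (i, j) (k, l) := by
    intro i j k l
    fin_cases i <;> fin_cases j <;> fin_cases k <;> fin_cases l <;> simp [detMatrix] <;> norm_num
  ext ⟨i, j⟩ ⟨k, l⟩
  simp only [Matrix.map_apply, Matrix.sum_apply, symProj, Matrix.of_apply]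
  rw [← Complex.ofReal_sum, ← Finset.sum_div, Finset.sum_add_distrib, hentry, hentry, hanti]
  have : w (i, l) (k, j) = w (i, j) (k, l) := by
    rw [hpt, ← congrFun (congrFun hsymm (k, l)) (i, j)]; rfl
  rw [this]
  congr 1
  ring

theorem symProj_smul (r : ℝ) (φ : Fin 2 × Fin 2 → ℝ) :
    symProj (r • φ) = ((r ^ 2 : ℝ) : ℂ) • symProj φ := by
  ext p q
  simp [symProj]; ring

theorem expect_smul_left (W ρ : Op) (r : ℝ) : expect ((r : ℂ) • W) ρ = r * expect W ρ := by
  simp [expect, Matrix.trace_smul]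

/-- For a product vector `ψ`, the operator `symProj ψ` is the projector of `ψ`, so it has nonnegative
expectation values. -/
theorem expect_symProj_nonneg_of_coeffDet_eq_zero {ψ : Fin 2 × Fin 2 → ℝ} (h : coeffDet ψ = 0)
    {ρ : Op} (hρ : ρ.PosSemidef) : 0 ≤ expect (symProj ψ) ρ := by
  obtain ⟨x, y, hxy⟩ := exists_eq_mul_of_coeffDet_eq_zero h
  have hψ : symProj ψ = realProj ψ := by
    ext p q
    simp [symProj, realProj, ketBra, Matrix.vecMulVec, hxy]
    ring
  have h1 := hρ.dotProduct_mulVec_nonneg (fun p => (ψ p : ℂ))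
  have h2 : expect (symProj ψ) ρ =
      (star (fun p => (ψ p : ℂ)) ⬝ᵥ ρ.mulVec (fun p => (ψ p : ℂ))).re := by
    rw [hψ, expect, realProj, ketBra, Matrix.vecMulVec_mul, Matrix.trace_vecMulVec,
      dotProduct_comm, Matrix.dotProduct_mulVec]
  rw [h2]
  exact (Complex.nonneg_iff.1 h1).1

theorem exists_detects_of_mem_EW4 {W ρ : Op} (hW : W ∈ EW4) (h : Detects W ρ) :
    ∃ φ, IsEntangled (realProj φ) ∧ Detects (symProj φ) ρ := by
  obtain ⟨m, ψ, rfl⟩ := exists_eq_sum_symProj hW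
  obtain ⟨hρ, hneg⟩ := h
  rw [expect_sum_left] at hneg
  obtain ⟨k, -, hk⟩ := Finset.exists_lt_of_sum_lt (s := Finset.univ) (g := fun _ => (0 : ℝ))
    (by simpa using hneg)
  have hdet : coeffDet (ψ k) ≠ 0 := fun h0 =>
    absurd (expect_symProj_nonneg_of_coeffDet_eq_zero h0 hρ.1.1) hk.not_ge
  obtain ⟨r, hr, hr1⟩ := exists_pos_smul_normalized (z := ψ k) fun h => hdet (by simp [h, coeffDet])
  refine ⟨r • ψ k, (isEntangled_realProj_iff _).2 ⟨hr1, ?_⟩, hρ, ?_⟩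
  · rw [coeffDet_smul]
    exact mul_ne_zero (pow_ne_zero 2 hr.ne') hdet
  · rw [symProj_smul, expect_smul_left]
    exact mul_neg_of_pos_of_neg (by positivity) hk

/-! ### Optimality -/

/-- An operator that detects everything detected by `symProj φ` is nonpositive on the product vectors
orthogonal to `φ`. -/
theorem expect_nonpos_of_finer {φ z : Fin 2 × Fin 2 → ℝ} {W : Op} (h : IsEntangled (realProj φ))
    (hW : ∀ ρ, Detects (symProj φ) ρ → Detects W ρ) (hz : z ⬝ᵥ z = 1) (hdet : coeffDet z = 0)
    (horth : φ ⬝ᵥ z = 0) : expect W (realProj z) ≤ 0 := by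
  by_contra! hpos
  obtain ⟨hV, hVneg⟩ := detects_twist h
  have hB := (hW _ (detects_twist h)).2
  set A := expect W (realProj z)
  set B := expect W (realProj (twist φ))
  set V := realProj (twist φ)
  have hAB : 0 < A - B := by linarith
  -- With these weights the mixture has expectation exactly zero in `W`, yet `symProj φ` still
  -- detects it.
  have ha : 0 < -B / (A - B) := div_pos (by linarith) hAB
  have hb : 0 < A / (A - B) := div_pos hpos hAB
  set a := -B / (A - B) with ha'
  set b := A / (A - B) with hb'
  have hab : a + b = 1 := by rw [ha', hb']; field_simp; ring
  have hzero : expect (symProj φ) (realProj z) = 0 := by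
    rw [expect_symProj_realProj, horth, hdet]; ring
  have hneg : expect (symProj φ) (a • realProj z + b • V) < 0 := by
    rw [expect_add_right, expect_smul_right, expect_smul_right, hzero]
    nlinarith [mul_pos hb (neg_pos.2 hVneg)]
  have hzs := (isState_realProj_iff z).2 hz
  have hstate : IsState (a • realProj z + b • V) := by
    refine ⟨(hzs.1.smul ha.le).add (hV.1.1.smul hb.le), ?_⟩
    rw [Matrix.trace_add, Matrix.trace_smul, Matrix.trace_smul, hzs.2, hV.1.2, ← add_smul, hab,
      one_smul]
  have h1 := (hW _ ⟨isEntangled_of_expect_neg hstate hneg, hneg⟩).2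
  rw [expect_add_right, expect_smul_right, expect_smul_right] at h1
  change a * A + b * B < 0 at h1
  have h2 : a * A + b * B = 0 := by rw [ha', hb']; field_simp; ring
  linarith

/-- If a real vector is orthogonal to all product vectors orthogonal to an entangled `φ`, then it is
a multiple of `φ`. -/
theorem exists_eq_smul_of_orthogonal {φ ψ : Fin 2 × Fin 2 → ℝ} (hφ : coeffDet φ ≠ 0)
    (h : ∀ z, coeffDet z = 0 → φ ⬝ᵥ z = 0 → ψ ⬝ᵥ z = 0) : ∃ r : ℝ, ψ = r • φ := by
  -- The test vectors are `x ⊗ y` with `x = e₀, e₁, e₀ + e₁` and `y` orthogonal to the matching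
  -- combination of rows of `φ`. The first two make rows of `ψ` and `φ` parallel; the third equates
  -- the factors.
  have h1 := h (fun p => if p.1 = 0 then (if p.2 = 0 then -φ (0, 1) else φ (0, 0)) else 0)
    (by simp [coeffDet]) (by simp [dotProduct, Fintype.sum_prod_type]; ring)
  have h2 := h (fun p => if p.1 = 0 then 0 else (if p.2 = 0 then -φ (1, 1) else φ (1, 0)))
    (by simp [coeffDet]) (by simp [dotProduct, Fintype.sum_prod_type]; ring)
  have h3 := h (fun p => if p.2 = 0 then -φ (0, 1) - φ (1, 1) else φ (0, 0) + φ (1, 0))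
    (by simp [coeffDet]; ring) (by simp [dotProduct, Fintype.sum_prod_type]; ring)
  simp [dotProduct, Fintype.sum_prod_type] at h1 h2 h3
  refine ⟨(ψ (0, 0) * φ (1, 1) - ψ (0, 1) * φ (1, 0)) / coeffDet φ, ?_⟩
  ext ⟨i, j⟩
  rw [Pi.smul_apply, smul_eq_mul, div_mul_eq_mul_div, eq_div_iff hφ]
  unfold coeffDet
  fin_cases i <;> fin_cases j <;> simp
  · linear_combination φ (1, 0) * h1
  · linear_combination φ (1, 1) * h1
  · linear_combination φ (1, 0) * (h3 - h1 - h2) - φ (0, 0) * h2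
  · linear_combination φ (1, 1) * (h3 - h1 - h2) - φ (0, 1) * h2

theorem isOptimalIn_symProj {φ : Fin 2 × Fin 2 → ℝ} (h : IsEntangled (realProj φ)) :
    IsOptimalIn EW4 (symProj φ) := by
  refine ⟨symProj_mem_EW4 h, fun W' hW' hdom => ?_⟩
  obtain ⟨m, ψ, hψ⟩ := exists_eq_sum_symProj hW'
  have hmul : ∀ k, ∃ r : ℝ, ψ k = r • φ := by
    intro k
    refine exists_eq_smul_of_orthogonal ((isEntangled_realProj_iff φ).1 h).2 fun z hz horth => ?_
    by_cases h0 : z = 0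
    · simp [h0]
    obtain ⟨c, hc, hc1⟩ := exists_pos_smul_normalized h0
    have hzd : coeffDet (c • z) = 0 := by rw [coeffDet_smul, hz, mul_zero]
    have h1 := expect_nonpos_of_finer h hdom hc1 hzd (by rw [dotProduct_smul, horth, smul_zero])
    rw [hψ, expect_sum_left] at h1
    simp only [expect_symProj_realProj, hzd, mul_zero, sub_zero] at h1
    have h2 := (Finset.sum_eq_zero_iff_of_nonneg fun k _ => sq_nonneg (ψ k ⬝ᵥ c • z)).1
      (le_antisymm h1 (Finset.sum_nonneg fun k _ => sq_nonneg _)) k (Finset.mem_univ k)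
    rw [sq_eq_zero_iff, dotProduct_smul, smul_eq_mul] at h2
    exact (mul_eq_zero.1 h2).resolve_left hc.ne'
  choose r hr using hmul
  have hsum : W' = ((∑ k, r k ^ 2 : ℝ) : ℂ) • symProj φ := by
    rw [hψ, Complex.ofReal_sum, Finset.sum_smul]
    exact Finset.sum_congr rfl fun k _ => by rw [hr k, symProj_smul]
  refine ⟨_, lt_of_le_of_ne (Finset.sum_nonneg fun k _ => sq_nonneg (r k)) fun h0 => ?_, hsum⟩
  have h1 := (hdom _ (detects_twist h)).2
  rw [hsum, expect_smul_left, ← h0, zero_mul] at h1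
  exact lt_irrefl _ h1

end TwoQubit

theorem theorem2 (T : TwoQubit.Op → TwoQubit.Op)
    (hT : T = TwoQubit.partialTransposeA ∨ T = TwoQubit.partialTransposeB) :
    (∀ W ∈ TwoQubit.realFamily T,
      TwoQubit.IsWitness W ∧ W ∈ TwoQubit.EW4 ∧ TwoQubit.IsOptimalIn TwoQubit.EW4 W) ∧
    (∀ ρ : TwoQubit.Op, TwoQubit.IsEntangled ρ →
      (∃ W ∈ TwoQubit.EW4, TwoQubit.Detects W ρ) →
        ∃ W ∈ TwoQubit.realFamily T, TwoQubit.Detects W ρ) := by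
  constructor
  · rintro _ ⟨φ, hφ, rfl⟩
    rw [TwoQubit.half_smul_realProj_add hT]
    exact ⟨TwoQubit.isWitness_symProj hφ, TwoQubit.symProj_mem_EW4 hφ,
      TwoQubit.isOptimalIn_symProj hφ⟩
  · rintro ρ - ⟨W, hW, hdet⟩
    obtain ⟨φ, hφ, hd⟩ := TwoQubit.exists_detects_of_mem_EW4 hW hdet
    exact ⟨_, ⟨φ, hφ, (TwoQubit.half_smul_realProj_add hT φ).symm⟩, hd⟩
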